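/- Let $m\ge 1$ and let $(M^{2m},\langle\cdot,\cdot\rangle,J)$ be a connected Kähler manifold of real dimension $2m$, that is, a connected smooth Riemannian manifold with a smooth orthogonal almost complex structure $J$ (so $J^2=-\mathrm{id}$ and $\langle JX,JY\rangle=\langle X,Y\rangle$) which is parallel for the Levi-Civita connection, $\nabla J=0$. Assume that the weak maximum principle for the Hessian holds on $M$: for every $u\in C^2(M)$ with $u^*=\sup_M u<+\infty$ there is a sequence $\{x_k\}_{k\ge1}\subset M$ such that, for every $k\ge 1$, $$u(x_k)>u^*-\frac1k,\qquad \sup_{v\in T_{x_k}M,\ |v|=1}\mathrm{Hess}_{x_k}u(v,v)<\frac1k .$$ Then $M$ cannot be isometrically immersed into a non-degenerate cone of $\mathbb{R}^{3m-1}$: there are no smooth isometric immersion $\varphi:M\to\mathbb{R}^{3m-1}$, point $o\in\mathbb{R}^{3m-1}$, unit vector $v\in\mathbb{R}^{3m-1}$ and $\theta\in(0,\pi/2)$ such that $$\varphi(M)\subseteq\mathcal{C}_{o,v,\theta}=\Big\{z\in\mathbb{R}^{3m-1}\setminus\{o\}:\ \Big\langle\frac{z-o}{|z-o|},v\Big\rangle\ge\cos\theta\Big\}.$$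 -/

import Mathlib

open scoped Manifold ContDiff Bundle

noncomputable section

namespace KahlerCone

section Riemannian

/-! ### Levi-Civita calculus in coordinates

`M` is an `n`-dimensional manifold. For `x₀ : M`, the chart of `M` at `x₀` is
`extChartAt (𝓡 n) x₀`, and points of its target are written `y`. -/

variable {n : ℕ} {M : Type*} [TopologicalSpace M] [ChartedSpace (EuclideanSpace ℝ (Fin n)) M]

/-- The `i`-th coordinate vector field `∂ᵢ` of the chart at `x₀`, at the point with
coordinates `y`. -/
def coordField (x₀ : M) (y : EuclideanSpace ℝ (Fin n)) (i : Fin n) :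
    TangentSpace (𝓡 n) ((extChartAt (𝓡 n) x₀).symm y) :=
  mfderiv 𝓘(ℝ, EuclideanSpace ℝ (Fin n)) (𝓡 n) (extChartAt (𝓡 n) x₀).symm y
    (EuclideanSpace.single i (1 : ℝ))

/-- The components of a tangent vector `v` at `p` in the chart at `x₀`. -/
def coords (x₀ p : M) (v : TangentSpace (𝓡 n) p) : EuclideanSpace ℝ (Fin n) :=
  mvfderiv (𝓡 n) (extChartAt (𝓡 n) x₀) p v

/-- The partial derivative `∂ᵢ f` at `y`. -/
def partialDeriv (f : EuclideanSpace ℝ (Fin n) → ℝ) (i : Fin n)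
    (y : EuclideanSpace ℝ (Fin n)) : ℝ :=
  fderiv ℝ f y (EuclideanSpace.single i (1 : ℝ))

/-- The components `J^k_j` of a field of endomorphisms `J` in the chart at `x₀`, at the point with
coordinates `y`: `J ∂ⱼ = ∑ₖ J^k_j ∂ₖ`. -/
def endoComp (J : ∀ x : M, TangentSpace (𝓡 n) x →L[ℝ] TangentSpace (𝓡 n) x)
    (x₀ : M) (k j : Fin n) (y : EuclideanSpace ℝ (Fin n)) : ℝ :=
  coords x₀ ((extChartAt (𝓡 n) x₀).symm y)
    (J ((extChartAt (𝓡 n) x₀).symm y) (coordField x₀ y j)) k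

variable [Bundle.RiemannianBundle (fun x : M ↦ TangentSpace (𝓡 n) x)]

/-- The components `gᵢⱼ` of the metric in the chart at `x₀`. -/
def metricComp (x₀ : M) (i j : Fin n) (y : EuclideanSpace ℝ (Fin n)) : ℝ :=
  inner ℝ (coordField x₀ y i) (coordField x₀ y j)

/-- The Christoffel symbols of the Levi-Civita connection in the chart at `x₀`:
`Γ^k_ij = 1/2 ∑ₗ g^{kl} (∂ᵢ gⱼₗ + ∂ⱼ gᵢₗ - ∂ₗ gᵢⱼ)`. -/
def christoffel (x₀ : M) (k i j : Fin n) (y : EuclideanSpace ℝ (Fin n)) : ℝ :=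
  1 / 2 * ∑ l, (Matrix.of fun a b ↦ metricComp x₀ a b y)⁻¹ k l *
    (partialDeriv (metricComp x₀ j l) i y + partialDeriv (metricComp x₀ i l) j y
      - partialDeriv (metricComp x₀ i j) l y)

/-- The Hessian of a function with respect to the Levi-Civita connection, as a bilinear form on
the tangent space at `x`: `Hess u (v, w) = ∑ᵢⱼ (∂ᵢ∂ⱼ u - ∑ₖ Γ^k_ij ∂ₖ u) vⁱ wʲ`. -/
def hess (u : M → ℝ) (x : M) (v w : TangentSpace (𝓡 n) x) : ℝ :=
  ∑ i, ∑ j,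
    (partialDeriv (partialDeriv (u ∘ (extChartAt (𝓡 n) x).symm) j) i (extChartAt (𝓡 n) x x)
      - ∑ k, christoffel x k i j (extChartAt (𝓡 n) x x) *
          partialDeriv (u ∘ (extChartAt (𝓡 n) x).symm) k (extChartAt (𝓡 n) x x))
    * coords x x v i * coords x x w j

/-- The weak maximum principle for the Hessian: every `C²` function `u` on `M` with
`u* = sup u < ∞` admits a sequence `x_k` with `u (x_k) > u* - 1/k` and
`sup {Hess u (v, v) : v ∈ T_{x_k} M, |v| = 1} < 1/k` for all `k ≥ 1`.
The second supremum is taken in the extended reals. -/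
def WeakMaxPrincipleHess (n : ℕ) (M : Type*) [TopologicalSpace M]
    [ChartedSpace (EuclideanSpace ℝ (Fin n)) M]
    [Bundle.RiemannianBundle (fun x : M ↦ TangentSpace (𝓡 n) x)] : Prop :=
  ∀ u : M → ℝ, ContMDiff (𝓡 n) 𝓘(ℝ, ℝ) 2 u → BddAbove (Set.range u) →
    ∃ x : ℕ → M, ∀ k : ℕ, 1 ≤ k →
      (⨆ z, u z) - 1 / (k : ℝ) < u (x k) ∧
      (⨆ (v : TangentSpace (𝓡 n) (x k)) (_ : ‖v‖ = 1), (hess u (x k) v v : EReal))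
        < ((1 / (k : ℝ) : ℝ) : EReal)

/-- The component of `(∇_{∂ᵢ} J) ∂ⱼ` along `∂ₖ` in the chart at `x₀`:
`∂ᵢ J^k_j + ∑ₗ (Γ^k_il J^l_j - Γ^l_ij J^k_l)`. -/
def covDerivEndo (J : ∀ x : M, TangentSpace (𝓡 n) x →L[ℝ] TangentSpace (𝓡 n) x)
    (x₀ : M) (i j k : Fin n) (y : EuclideanSpace ℝ (Fin n)) : ℝ :=
  partialDeriv (endoComp J x₀ k j) i y
    + ∑ l, (christoffel x₀ k i l y * endoComp J x₀ l j y
      - christoffel x₀ l i j y * endoComp J x₀ k l y)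

/-- `J` makes the Riemannian manifold `M` a Kähler manifold: it is a smooth almost complex
structure, orthogonal for the metric and parallel for the Levi-Civita connection. -/
structure IsKahler [IsManifold (𝓡 n) ∞ M]
    (J : ∀ x : M, TangentSpace (𝓡 n) x →L[ℝ] TangentSpace (𝓡 n) x) : Prop where
  smooth : ContMDiff (𝓡 n)
    ((𝓡 n).prod 𝓘(ℝ, EuclideanSpace ℝ (Fin n) →L[ℝ] EuclideanSpace ℝ (Fin n))) ∞
    (fun x ↦ Bundle.TotalSpace.mk' (EuclideanSpace ℝ (Fin n) →L[ℝ] EuclideanSpace ℝ (Fin n))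
      (E := fun x : M ↦ TangentSpace (𝓡 n) x →L[ℝ] TangentSpace (𝓡 n) x) x (J x))
  sq_eq_neg : ∀ (x : M) (v : TangentSpace (𝓡 n) x), J x (J x v) = -v
  orthogonal : ∀ (x : M) (v w : TangentSpace (𝓡 n) x), inner ℝ (J x v) (J x w) = inner ℝ v w
  parallel : ∀ (x₀ : M), ∀ y ∈ (extChartAt (𝓡 n) x₀).target, ∀ i j k : Fin n,
    covDerivEndo J x₀ i j k y = 0

/-- A smooth isometric immersion of `M` into the Euclidean space `ℝᴺ`. -/
structure IsIsometricImmersion (n : ℕ) {M : Type*} [TopologicalSpace M]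
    [ChartedSpace (EuclideanSpace ℝ (Fin n)) M]
    [Bundle.RiemannianBundle (fun x : M ↦ TangentSpace (𝓡 n) x)]
    {N : ℕ} (φ : M → EuclideanSpace ℝ (Fin N)) : Prop where
  smooth : ContMDiff (𝓡 n) 𝓘(ℝ, EuclideanSpace ℝ (Fin N)) ∞ φ
  isometric : ∀ (x : M) (v w : TangentSpace (𝓡 n) x),
    inner ℝ (mvfderiv (𝓡 n) φ x v) (mvfderiv (𝓡 n) φ x w) = inner ℝ v w

end Riemannian

/-- The cone of `ℝᴺ` with vertex `o`, direction `v` and width `θ`. -/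
def cone {N : ℕ} (o v : EuclideanSpace ℝ (Fin N)) (θ : ℝ) : Set (EuclideanSpace ℝ (Fin N)) :=
  {z | z ≠ o ∧ Real.cos θ ≤ inner ℝ ((1 / ‖z - o‖) • (z - o)) v}

/-- A non-degenerate cone: unit direction, and width in `(0, π/2)`. -/
def IsNondegenerateCone {N : ℕ} (C : Set (EuclideanSpace ℝ (Fin N))) : Prop :=
  ∃ (o v : EuclideanSpace ℝ (Fin N)) (θ : ℝ),
    ‖v‖ = 1 ∧ 0 < θ ∧ θ < Real.pi / 2 ∧ C = cone o v θ

end KahlerCone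

end

/-! Let `α` be the second fundamental form. The curvature of a Kähler manifold commutes with `J`, so
by the Gauss equation the bilinear form `(α(X,Y), α(X,JY))` is flat for the inner product of
signature `(+,-)` on two copies of the normal space. The codimension is `m - 1`, so the values lie
in dimension `2m - 2 < 2m`, and Moore's regular-element argument for flat forms gives `v ≠ 0` with
`α(v,v) + α(Jv,Jv) = 0` at every point (`exists_regular`, `exists_add_eq_zero`).

For a function `h` on Euclidean space, `Hess (h ∘ φ)(t,t) = Hess h (dφ t, dφ t) + ⟨grad h, α(t,t)⟩`.
The last term is nonnegative for one of `v`, `Jv`, so in some unit direction the Hessian of `h ∘ φ`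
is at least that of `h` (`exists_le_hess`). Take the convex function `h(z) = √(1 + a²|z-o|²) - ⟨v,
z-o⟩` with `v` the axis of the cone and `a = cos θ / 2`. On the cone, `h ≤ 1 - a|z-o|`. Hence `h ∘
φ` is bounded above, and `φ` stays bounded along a maximizing sequence. There `Hess h` is bounded
below by a positive constant, against the weak maximum principle. -/

open scoped Manifold ContDiff Bundle

noncomputable section

namespace KahlerCone

/-! ### Flat bilinear forms -/

section FlatForms

open Filter Topology Module

/-- A bilinear map into a finite-dimensional space has a regular element `x`: the image of
`ker (B x)` under any `B z` is contained in the range of `B x`. -/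
theorem exists_regular {V V' W : Type*} [AddCommGroup V] [Module ℝ V] [AddCommGroup V']
    [Module ℝ V'] [NormedAddCommGroup W] [NormedSpace ℝ W] [FiniteDimensional ℝ W]
    (B : V →ₗ[ℝ] V' →ₗ[ℝ] W) :
    ∃ x, ∀ z n, B x n = 0 → B z n ∈ LinearMap.range (B x) := by
  obtain ⟨x, hx⟩ : ∃ x, ∀ z, finrank ℝ (LinearMap.range (B z)) ≤
      finrank ℝ (LinearMap.range (B x)) := by
    have hfin : (Set.range fun z ↦ finrank ℝ (LinearMap.range (B z))).Finite :=
      (Set.finite_Iic (finrank ℝ W)).subset (by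
        rintro _ ⟨z, rfl⟩
        exact Submodule.finrank_le _)
    obtain ⟨_, ⟨x, rfl⟩, hx⟩ := hfin.exists_maximal (Set.range_nonempty _)
    exact ⟨x, fun z ↦ (le_total _ _).elim id fun h ↦ hx ⟨z, rfl⟩ h⟩
  refine ⟨x, fun z n hn ↦ ?_⟩
  by_contra hz
  set r := finrank ℝ (LinearMap.range (B x)) with hr
  let b := finBasis ℝ (LinearMap.range (B x))
  choose y hy using fun i ↦ (b i).2
  have hb : LinearIndependent ℝ (fun i ↦ B x (y i)) := by
    have := b.linearIndependent.map' (LinearMap.range (B x)).subtype (Submodule.ker_subtype _)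
    rwa [show (fun i ↦ B x (y i)) = (LinearMap.range (B x)).subtype ∘ b from funext hy]
  have hspan : Submodule.span ℝ (Set.range fun i ↦ B x (y i)) ≤ LinearMap.range (B x) :=
    Submodule.span_le.2 (by rintro _ ⟨i, rfl⟩; exact ⟨y i, rfl⟩)
  have h0 : LinearIndependent ℝ (Fin.cons (B z n) fun i ↦ B x (y i) : Fin (r + 1) → W) :=
    linearIndependent_finCons.2 ⟨hb, fun h ↦ hz (hspan h)⟩
  -- Perturb `x` to `x + t • z`. Since `B x n = 0`, for `t ≠ 0` the vector `B z n` is the image of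
  -- `t⁻¹ • n`. Independence persists for small `t`, so the rank would exceed its maximum `r`.
  let F : ℝ → Fin (r + 1) → W := fun t ↦ Fin.cons (B z n) fun i ↦ B x (y i) + t • B z (y i)
  have hF : Continuous F := by
    refine continuous_pi fun i ↦ ?_
    refine Fin.cases ?_ (fun i ↦ ?_) i
    · exact continuous_const
    · simp only [F, Fin.cons_succ]
      fun_prop
  have hev : ∀ᶠ t in 𝓝 (0 : ℝ), LinearIndependent ℝ (F t) := by
    refine hF.continuousAt.eventually (isOpen_setOfPred_linearIndependent.mem_nhds ?_)
    simpa [F] using h0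
  obtain ⟨t, ht, ht0⟩ : ∃ t : ℝ, LinearIndependent ℝ (F t) ∧ t ≠ 0 :=
    ((hev.filter_mono nhdsWithin_le_nhds).and
      (self_mem_nhdsWithin : {(0 : ℝ)}ᶜ ∈ 𝓝[≠] (0 : ℝ))).exists
  have hmem : ∀ i, F t i ∈ LinearMap.range (B (x + t • z)) := by
    refine Fin.cases ?_ fun i ↦ ?_
    · exact ⟨t⁻¹ • n, by simp [F, hn, ht0]⟩
    · exact ⟨y i, by simp [F]⟩
  have hli : LinearIndependent ℝ
      (fun i ↦ (⟨F t i, hmem i⟩ : LinearMap.range (B (x + t • z)))) :=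
    LinearIndependent.of_comp (LinearMap.range (B (x + t • z))).subtype ht
  have := hli.fintype_card_le_finrank
  have := hx (x + t • z)
  simp at *
  omega

/-- A symmetric bilinear form `α` satisfying the Gauss equation of a Kähler submanifold, with
values in a space of dimension less than half the dimension of `V`, is not definite on the
`J`-invariant part of its diagonal. -/
theorem exists_add_eq_zero {V W : Type*} [AddCommGroup V] [Module ℝ V] [FiniteDimensional ℝ V]
    [NormedAddCommGroup W] [InnerProductSpace ℝ W] [FiniteDimensional ℝ W]
    (α : V →ₗ[ℝ] V →ₗ[ℝ] W) (J : V →ₗ[ℝ] V) (hsymm : ∀ x y, α x y = α y x)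
    (hJ : ∀ x, J (J x) = -x)
    (hflat : ∀ x y z t, inner ℝ (α x y) (α z t) - inner ℝ (α z y) (α x t) =
      inner ℝ (α x (J y)) (α z (J t)) - inner ℝ (α z (J y)) (α x (J t)))
    (hdim : 2 * finrank ℝ W < finrank ℝ V) :
    ∃ n, n ≠ 0 ∧ α n n + α (J n) (J n) = 0 := by
  let B : V →ₗ[ℝ] V →ₗ[ℝ] W × W :=
    LinearMap.mk₂ ℝ (fun x y ↦ (α x y, α x (J y))) (by simp) (by simp) (by simp) (by simp)
  have hB : ∀ x y, B x y = (α x y, α x (J y)) := fun _ _ ↦ rfl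
  obtain ⟨x, hx⟩ := exists_regular B
  obtain ⟨n, hn, hn0⟩ : ∃ n ∈ LinearMap.ker (B x), n ≠ 0 := by
    refine (Submodule.ne_bot_iff _).1 (LinearMap.ker_ne_bot_of_finrank_lt ?_)
    rw [Module.finrank_prod]
    omega
  have hker : ∀ k, B x k = 0 ↔ α x k = 0 ∧ α x (J k) = 0 := fun k ↦ by
    rw [hB, Prod.mk_eq_zero]
  have hn1 : B x n = 0 := hn
  have hJn : B x (J n) = 0 := by
    rw [hker] at hn1 ⊢
    simp [hJ, hn1]
  -- Regularity writes `B z k` as `B x y`. Flatness at `x, y, w, l` then loses the terms containing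
  -- `α x l` and `α x (J l)`.
  have iso : ∀ z w k l, B x k = 0 → B x l = 0 →
      inner ℝ (α z k) (α w l) = inner ℝ (α z (J k)) (α w (J l)) := by
    intro z w k l hk hl
    obtain ⟨y, hy⟩ := hx z k hk
    rw [hB, hB, Prod.mk.injEq] at hy
    rw [hker] at hl
    have := hflat x y w l
    rw [hl.1, hl.2, hy.1, hy.2] at this
    simpa [sub_eq_zero] using this
  refine ⟨n, hn0, ?_⟩
  -- With `c = |α(n,Jn)|²`, these give `|α(n,n)|² = |α(Jn,Jn)|² = c` and `⟨α(n,n), α(Jn,Jn)⟩ = -c`,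
  -- so the sum has norm zero.
  have e1 := iso n n n n hn1 hn1
  have e2 := iso n (J n) n (J n) hn1 hJn
  have e3 := iso (J n) (J n) n n hn1 hn1
  simp only [hJ, map_neg, inner_neg_right, hsymm (J n) n] at e2 e3
  rw [← inner_self_eq_zero (𝕜 := ℝ), inner_add_left, inner_add_right, inner_add_right,
    real_inner_comm (α n n) (α (J n) (J n))]
  linarith

end FlatForms

/-! ### Gauss equation by comparing a frame with its image under `J` -/

section Frames

open Filter Topology

variable {n : ℕ} {F : Type*} [NormedAddCommGroup F] [InnerProductSpace ℝ F]

/-- Symmetry of second derivatives, tested against a second field `h`. -/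
theorem inner_fderiv_sub_inner_fderiv {E : Type*} [NormedAddCommGroup E] [NormedSpace ℝ E]
    {f h : E → F} {y : E} (hf : ContDiffAt ℝ 2 f y) (hh : ContDiffAt ℝ 2 h y) (a b : E) :
    inner ℝ (fderiv ℝ f y a) (fderiv ℝ h y b) - inner ℝ (fderiv ℝ f y b) (fderiv ℝ h y a) =
      fderiv ℝ (fun z ↦ inner ℝ (fderiv ℝ f z a) (h z)) y b -
        fderiv ℝ (fun z ↦ inner ℝ (fderiv ℝ f z b) (h z)) y a := by
  have hf' : DifferentiableAt ℝ (fderiv ℝ f) y :=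
    (hf.fderiv_right (m := 1) (by norm_num)).differentiableAt (by norm_num)
  have hh' : DifferentiableAt ℝ h y := hh.differentiableAt (by norm_num)
  have hs : IsSymmSndFDerivAt ℝ f y := hf.isSymmSndFDerivAt (by simp)
  have key : ∀ a b, fderiv ℝ (fun z ↦ inner ℝ (fderiv ℝ f z a) (h z)) y b =
      inner ℝ (fderiv ℝ f y a) (fderiv ℝ h y b) +
        inner ℝ (fderiv ℝ (fderiv ℝ f) y b a) (h y) := by
    intro a b
    rw [fderiv_inner_apply ℝ (by fun_prop) hh', fderiv_clm_apply hf' (by fun_prop)]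
    simp
  rw [key, key, hs.eq a b]
  ring

/-- The normal part of `∂ᵢ fⱼ`, for a frame `f` with connection coefficients `Γ`. -/
def normalPart (f : Fin n → EuclideanSpace ℝ (Fin n) → F)
    (Γ : Fin n → Fin n → Fin n → EuclideanSpace ℝ (Fin n) → ℝ)
    (y : EuclideanSpace ℝ (Fin n)) (i j : Fin n) : F :=
  fderiv ℝ (f j) y (EuclideanSpace.single i 1) - ∑ k, Γ k i j y • f k y

variable {f : Fin n → EuclideanSpace ℝ (Fin n) → F}
    {Γ : Fin n → Fin n → Fin n → EuclideanSpace ℝ (Fin n) → ℝ}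
    {c : Fin n → Fin n → EuclideanSpace ℝ (Fin n) → ℝ} {y : EuclideanSpace ℝ (Fin n)}

/-- The derivative of the frame `∑ₖ cᵏⱼ fₖ` when the field of endomorphisms `c` is parallel. -/
theorem fderiv_rotated_frame (hf : ∀ j, DifferentiableAt ℝ (f j) y)
    (hc : ∀ k j, DifferentiableAt ℝ (c k j) y)
    (hpar : ∀ i j k, partialDeriv (c k j) i y +
      ∑ l, (Γ k i l y * c l j y - Γ l i j y * c k l y) = 0) (i j : Fin n) :
    fderiv ℝ (fun z ↦ ∑ k, c k j z • f k z) y (EuclideanSpace.single i 1) =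
      ∑ l, Γ l i j y • ∑ k, c k l y • f k y + ∑ a, c a j y • normalPart f Γ y i a := by
  have h : HasFDerivAt (fun z ↦ ∑ k, c k j z • f k z)
      (∑ k, (c k j y • fderiv ℝ (f k) y + (fderiv ℝ (c k j) y).smulRight (f k y))) y :=
    HasFDerivAt.fun_sum fun k _ ↦ (hc k j).hasFDerivAt.smul (hf k).hasFDerivAt
  rw [h.fderiv]
  have h1 : ∀ k, fderiv ℝ (c k j) y (EuclideanSpace.single i 1) =
      -∑ l, (Γ k i l y * c l j y - Γ l i j y * c k l y) := fun k ↦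
    eq_neg_of_add_eq_zero_left (hpar i j k)
  simp only [sum_apply, add_apply,
    smul_apply, ContinuousLinearMap.smulRight_apply, h1, normalPart, smul_sub,
    Finset.sum_sub_distrib, Finset.sum_add_distrib, neg_smul, sub_smul, Finset.sum_smul,
    Finset.smul_sum, Finset.sum_neg_distrib, smul_smul]
  -- After exchanging the sums, the terms `Γ k i l * c l j` from the derivative of `c` match the
  -- tangential terms subtracted in `normalPart`.
  rw [Finset.sum_comm (f := fun x k ↦ (Γ x i j y * c k x y) • f k y),
    Finset.sum_comm (f := fun x k ↦ (c x j y * Γ k i x y) • f k y)]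
  simp only [mul_comm (c _ j y)]
  abel

/-- The Gauss equation for a frame rotated by a parallel orthogonal field of endomorphisms. -/
theorem gauss_rotated_frame (hf : ∀ j, ContDiffAt ℝ 2 (f j) y)
    (hc : ∀ k j, ContDiffAt ℝ 2 (c k j) y)
    (hpar : ∀ᶠ z in 𝓝 y, ∀ i j k, partialDeriv (c k j) i z +
      ∑ l, (Γ k i l z * c l j z - Γ l i j z * c k l z) = 0)
    (horth : ∀ᶠ z in 𝓝 y, ∀ j l,
      inner ℝ (∑ k, c k j z • f k z) (∑ k, c k l z • f k z) = inner ℝ (f j z) (f l z))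
    (hnorm : ∀ᶠ z in 𝓝 y, ∀ i j l, inner ℝ (normalPart f Γ z i j) (f l z) = 0)
    (i j k l : Fin n) :
    inner ℝ (normalPart f Γ y i j) (normalPart f Γ y k l) -
        inner ℝ (normalPart f Γ y k j) (normalPart f Γ y i l) =
      inner ℝ (∑ a, c a j y • normalPart f Γ y i a) (∑ a, c a l y • normalPart f Γ y k a) -
        inner ℝ (∑ a, c a j y • normalPart f Γ y k a)
          (∑ a, c a l y • normalPart f Γ y i a) := by
  have hfd : ∀ᶠ z in 𝓝 y, ∀ j, DifferentiableAt ℝ (f j) z :=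
    eventually_all.2 fun j ↦ ((hf j).eventually (by simp)).mono
      fun z hz ↦ hz.differentiableAt (by norm_num)
  have hcd : ∀ᶠ z in 𝓝 y, ∀ k j, DifferentiableAt ℝ (c k j) z :=
    eventually_all.2 fun k ↦ eventually_all.2 fun j ↦ ((hc k j).eventually (by simp)).mono
      fun z hz ↦ hz.differentiableAt (by norm_num)
  set K : Fin n → EuclideanSpace ℝ (Fin n) → F := fun j z ↦ ∑ k, c k j z • f k z with hK
  have hoK : ∀ᶠ z in 𝓝 y, ∀ j l, inner ℝ (K j z) (K l z) = inner ℝ (f j z) (f l z) := horth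
  have hK2 : ∀ j, ContDiffAt ℝ 2 (K j) y := fun j ↦
    ContDiffAt.sum fun k _ ↦ (hc k j).smul (hf k)
  have hF : ∀ z i j, fderiv ℝ (f j) z (EuclideanSpace.single i 1) =
      ∑ k, Γ k i j z • f k z + normalPart f Γ z i j := fun z i j ↦ by
    simp [normalPart]
  have hKd : ∀ᶠ z in 𝓝 y, ∀ i j, fderiv ℝ (K j) z (EuclideanSpace.single i 1) =
      ∑ l, Γ l i j z • K l z + ∑ a, c a j z • normalPart f Γ z i a := by
    filter_upwards [hfd, hcd, hpar] with z h1 h2 h3 i j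
    exact fderiv_rotated_frame h1 h2 h3 i j
  have hnK : ∀ᶠ z in 𝓝 y, ∀ i j l,
      inner ℝ (∑ a, c a j z • normalPart f Γ z i a) (K l z) = 0 := by
    filter_upwards [hnorm] with z hz i j l
    simp only [hK, sum_inner, inner_sum, inner_smul_left, inner_smul_right, hz, mul_zero,
      Finset.sum_const_zero]
  -- The rotated frame `K` has the same coefficients `Γ` and the same Gram matrix as `f`. The
  -- right-hand sides of `inner_fderiv_sub_inner_fderiv` therefore agree for both frames, which
  -- replaces the identity between curvatures.
  have hconn : ∀ i j l, (fun z ↦ inner ℝ (fderiv ℝ (K j) z (EuclideanSpace.single i 1)) (K l z))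
      =ᶠ[𝓝 y] fun z ↦ inner ℝ (fderiv ℝ (f j) z (EuclideanSpace.single i 1)) (f l z) := by
    intro i j l
    filter_upwards [hnK, hKd, hnorm, hoK] with z h1 h2 h3 h4
    rw [h2, hF, inner_add_left, inner_add_left, h1, h3]
    simp only [sum_inner, inner_smul_left, h4]
  have e1 := inner_fderiv_sub_inner_fderiv (hf j) (hf l) (EuclideanSpace.single i 1)
    (EuclideanSpace.single k 1)
  have e2 := inner_fderiv_sub_inner_fderiv (hK2 j) (hK2 l) (EuclideanSpace.single i 1)
    (EuclideanSpace.single k 1)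
  rw [(hconn i j l).fderiv_eq, (hconn k j l).fderiv_eq, ← e1] at e2
  have hn0 := hnorm.self_of_nhds
  have hnK0 := hnK.self_of_nhds
  have ho0 := hoK.self_of_nhds
  have split : ∀ {p q p' q' : F}, inner ℝ q p' = 0 → inner ℝ q' p = 0 →
      inner ℝ (p + q) (p' + q') = inner ℝ p p' + inner ℝ q q' := by
    intro p q p' q' h h'
    rw [inner_add_left, inner_add_right, inner_add_right, h, real_inner_comm q' p, h']
    ring
  have hcombf : ∀ i j k l, inner ℝ (normalPart f Γ y i j) (∑ a, Γ a k l y • f a y) = 0 := by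
    intro i j k l
    simp only [inner_sum, inner_smul_right, hn0, mul_zero, Finset.sum_const_zero]
  have hcombK : ∀ i j k l, inner ℝ (∑ a, c a j y • normalPart f Γ y i a)
      (∑ a, Γ a k l y • K a y) = 0 := by
    intro i j k l
    rw [inner_sum]
    simp only [inner_smul_right, hnK0, mul_zero, Finset.sum_const_zero]
  have htan : ∀ i j k l, inner ℝ (∑ a, Γ a i j y • K a y) (∑ a, Γ a k l y • K a y) =
      inner ℝ (∑ a, Γ a i j y • f a y) (∑ a, Γ a k l y • f a y) := by
    intro i j k l
    simp only [sum_inner, inner_sum, inner_smul_left, inner_smul_right, ho0]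
  simp only [hKd.self_of_nhds, hF] at e2
  rw [split (hcombf _ _ _ _) (hcombf _ _ _ _), split (hcombf _ _ _ _) (hcombf _ _ _ _),
    split (hcombK _ _ _ _) (hcombK _ _ _ _), split (hcombK _ _ _ _) (hcombK _ _ _ _),
    htan, htan] at e2
  linarith

end Frames

/-! ### Second fundamental form of an immersed coordinate patch -/

section Immersions

open Filter Topology

variable {n : ℕ} {F : Type*} [NormedAddCommGroup F] [InnerProductSpace ℝ F]
  {ψ : EuclideanSpace ℝ (Fin n) → F} {y : EuclideanSpace ℝ (Fin n)}

/-- The coordinate frame of a map `ψ`. -/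
def coordFrame (ψ : EuclideanSpace ℝ (Fin n) → F) (j : Fin n) (z : EuclideanSpace ℝ (Fin n)) : F :=
  fderiv ℝ ψ z (EuclideanSpace.single j 1)

theorem sum_smul_coordFrame (ψ : EuclideanSpace ℝ (Fin n) → F) (z v : EuclideanSpace ℝ (Fin n)) :
    ∑ j, v j • coordFrame ψ j z = fderiv ℝ ψ z v := by
  have hv : v = ∑ j, v j • EuclideanSpace.single j (1 : ℝ) := by
    have := (EuclideanSpace.basisFun (Fin n) ℝ).sum_repr v
    simpa using this.symm
  conv_rhs => rw [hv]
  simp [coordFrame]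

theorem contDiffAt_coordFrame (hψ : ContDiffAt ℝ 3 ψ y) (j : Fin n) :
    ContDiffAt ℝ 2 (coordFrame ψ j) y :=
  (hψ.fderiv_right (m := 2) (by norm_num)).clm_apply contDiffAt_const

theorem fderiv_coordFrame_symm (hψ : ContDiffAt ℝ 2 ψ y) (i j : Fin n) :
    fderiv ℝ (coordFrame ψ j) y (EuclideanSpace.single i 1) =
      fderiv ℝ (coordFrame ψ i) y (EuclideanSpace.single j 1) := by
  have hs : IsSymmSndFDerivAt ℝ ψ y := hψ.isSymmSndFDerivAt (by simp)
  have hd : DifferentiableAt ℝ (fderiv ℝ ψ) y :=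
    (hψ.fderiv_right (m := 1) (by norm_num)).differentiableAt (by norm_num)
  have key : ∀ a b : EuclideanSpace ℝ (Fin n),
      fderiv ℝ (fun z ↦ fderiv ℝ ψ z a) y b = fderiv ℝ (fderiv ℝ ψ) y b a := fun a b ↦ by
    rw [fderiv_clm_apply hd (by fun_prop)]
    simp
  exact (key _ _).trans ((hs.eq _ _).trans (key _ _).symm)

/-- The Gram matrix of the coordinate frame of an immersion is invertible. -/
theorem isUnit_gram_coordFrame (hinj : Function.Injective (fderiv ℝ ψ y)) :
    IsUnit (Matrix.of fun a b ↦ (inner ℝ (coordFrame ψ a y) (coordFrame ψ b y) : ℝ)) := by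
  rw [← Matrix.mulVec_injective_iff_isUnit, ← Matrix.coe_mulVecLin, ← LinearMap.ker_eq_bot,
    LinearMap.ker_eq_bot']
  intro v hv
  -- The Gram quadratic form at `v` is the squared norm of `dψ v`.
  have h0 : fderiv ℝ ψ y (WithLp.toLp 2 v) = 0 := by
    rw [← sum_smul_coordFrame, ← inner_self_eq_zero (𝕜 := ℝ), sum_inner]
    refine Finset.sum_eq_zero fun a _ ↦ ?_
    have := congrFun hv a
    simp only [Matrix.mulVecLin_apply, Matrix.mulVec, dotProduct, Matrix.of_apply,
      Pi.zero_apply] at this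
    rw [inner_smul_left, inner_sum]
    simp only [inner_smul_right, mul_comm (v _), this, mul_zero]
  have := hinj (h0.trans (map_zero _).symm)
  simpa using this

/-- The Levi-Civita connection of the induced metric is the tangential part of the derivative:
the Christoffel symbols subtract exactly the tangential part of the second derivative. -/
theorem inner_normalPart_coordFrame (hψ : ContDiffAt ℝ 3 ψ y)
    (hinj : Function.Injective (fderiv ℝ ψ y))
    (g : Fin n → Fin n → EuclideanSpace ℝ (Fin n) → ℝ)
    (hg : ∀ i j, g i j =ᶠ[𝓝 y] fun z ↦ inner ℝ (coordFrame ψ i z) (coordFrame ψ j z))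
    (Γ : Fin n → Fin n → Fin n → EuclideanSpace ℝ (Fin n) → ℝ)
    (hΓ : ∀ k i j, Γ k i j y = 1 / 2 * ∑ l, (Matrix.of fun a b ↦ g a b y)⁻¹ k l *
      (partialDeriv (g j l) i y + partialDeriv (g i l) j y - partialDeriv (g i j) l y))
    (i j l : Fin n) :
    inner ℝ (normalPart (coordFrame ψ) Γ y i j) (coordFrame ψ l y) = 0 := by
  have hd : ∀ j, DifferentiableAt ℝ (coordFrame ψ j) y := fun j ↦
    (contDiffAt_coordFrame hψ j).differentiableAt (by norm_num)
  have hsymm : ∀ i j, fderiv ℝ (coordFrame ψ j) y (EuclideanSpace.single i 1) =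
      fderiv ℝ (coordFrame ψ i) y (EuclideanSpace.single j 1) := fun i j ↦
    fderiv_coordFrame_symm (hψ.of_le (by norm_num)) i j
  have hpd : ∀ i j l, partialDeriv (g j l) i y =
      inner ℝ (coordFrame ψ j y) (fderiv ℝ (coordFrame ψ l) y (EuclideanSpace.single i 1)) +
      inner ℝ (fderiv ℝ (coordFrame ψ j) y (EuclideanSpace.single i 1)) (coordFrame ψ l y) := by
    intro i j l
    rw [partialDeriv, (hg j l).fderiv_eq, fderiv_inner_apply ℝ (hd j) (hd l)]
  set G : Matrix (Fin n) (Fin n) ℝ :=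
    Matrix.of fun a b ↦ inner ℝ (coordFrame ψ a y) (coordFrame ψ b y) with hG
  have hGg : (Matrix.of fun a b ↦ g a b y) = G := by
    ext a b
    exact (hg a b).eq_of_nhds
  have hinv : G * G⁻¹ = 1 :=
    Matrix.mul_nonsing_inv _ ((Matrix.isUnit_iff_isUnit_det _).1 (isUnit_gram_coordFrame hinj))
  set d := fderiv ℝ (coordFrame ψ j) y (EuclideanSpace.single i 1) with hdd
  -- Koszul's formula: of the six products from the three metric derivatives, four cancel by
  -- symmetry of second derivatives and two equal `⟨d, ∂ₗψ⟩`.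
  have hΓ' : ∀ k, Γ k i j y = ∑ l, G⁻¹ k l * inner ℝ d (coordFrame ψ l y) := by
    intro k
    rw [hΓ, hGg, Finset.mul_sum]
    refine Finset.sum_congr rfl fun l _ ↦ ?_
    rw [hpd, hpd, hpd, hsymm j i, hsymm l i, hsymm l j, ← hdd,
      real_inner_comm _ (coordFrame ψ j y)]
    ring
  have hfin : ∑ k, Γ k i j y * inner ℝ (coordFrame ψ k y) (coordFrame ψ l y) =
      inner ℝ d (coordFrame ψ l y) := by
    have : ∀ k, inner ℝ (coordFrame ψ k y) (coordFrame ψ l y) = G l k := fun k ↦ by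
      rw [real_inner_comm]; rfl
    simp only [this, hΓ', Finset.sum_mul]
    rw [Finset.sum_comm]
    have h1 : ∀ a, ∑ k, G⁻¹ k a * inner ℝ d (coordFrame ψ a y) * G l k =
        (G * G⁻¹) l a * inner ℝ d (coordFrame ψ a y) := by
      intro a
      rw [Matrix.mul_apply, Finset.sum_mul]
      exact Finset.sum_congr rfl fun k _ ↦ by ring
    simp only [h1, hinv, Matrix.one_apply, ite_mul, one_mul, zero_mul, Finset.sum_ite_eq,
      Finset.mem_univ, if_true]
  rw [normalPart, inner_sub_left, sum_inner, ← hdd]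
  simp only [inner_smul_left, RCLike.conj_to_real]
  rw [hfin, sub_self]

/-- The bilinear map with given values on pairs of coordinate vectors. -/
def bilinOfCoeff {W : Type*} [AddCommGroup W] [Module ℝ W] (a : Fin n → Fin n → W) :
    EuclideanSpace ℝ (Fin n) →ₗ[ℝ] EuclideanSpace ℝ (Fin n) →ₗ[ℝ] W :=
  LinearMap.mk₂ ℝ (fun x y ↦ ∑ i, ∑ j, (x i * y j) • a i j)
    (fun x x' y ↦ by simp [add_mul, add_smul, Finset.sum_add_distrib])
    (fun c x y ↦ by simp [Finset.smul_sum, smul_smul, mul_assoc])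
    (fun x y y' ↦ by simp [mul_add, add_smul, Finset.sum_add_distrib])
    (fun c x y ↦ by simp [Finset.smul_sum, smul_smul, mul_left_comm])

theorem bilinOfCoeff_apply {W : Type*} [AddCommGroup W] [Module ℝ W] (a : Fin n → Fin n → W)
    (x y : EuclideanSpace ℝ (Fin n)) :
    bilinOfCoeff a x y = ∑ i, ∑ j, (x i * y j) • a i j := rfl

theorem bilinOfCoeff_single_left {W : Type*} [AddCommGroup W] [Module ℝ W]
    (a : Fin n → Fin n → W) (i : Fin n) (y : EuclideanSpace ℝ (Fin n)) :
    bilinOfCoeff a (EuclideanSpace.single i 1) y = ∑ j, y j • a i j := by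
  rw [bilinOfCoeff_apply, Finset.sum_eq_single i]
  · simp
  · intro b _ hb
    simp [hb]
  · simp

/-- A linear functional vanishing on the coordinate vectors vanishes. -/
theorem eq_zero_of_single {f : EuclideanSpace ℝ (Fin n) → ℝ}
    (hadd : ∀ x y, f (x + y) = f x + f y) (hsmul : ∀ (c : ℝ) x, f (c • x) = c * f x)
    (h : ∀ i, f (EuclideanSpace.single i 1) = 0) (x : EuclideanSpace ℝ (Fin n)) : f x = 0 := by
  let L : EuclideanSpace ℝ (Fin n) →ₗ[ℝ] ℝ := ⟨⟨f, hadd⟩, hsmul⟩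
  have : L = 0 := (EuclideanSpace.basisFun (Fin n) ℝ).toBasis.ext fun i ↦ by simpa [L] using h i
  exact LinearMap.congr_fun this x

/-- The coordinate expression of the Hessian of a composition `h ∘ ψ`. -/
theorem hess_comp_eq (hψ : ContDiffAt ℝ 3 ψ y) {h : F → ℝ} {G : F → F} {G' : F →L[ℝ] F}
    (hh : ∀ z, HasFDerivAt h (innerSL ℝ (G z)) z) (hG : HasFDerivAt G G' (ψ y))
    (Γ : Fin n → Fin n → Fin n → EuclideanSpace ℝ (Fin n) → ℝ)
    (v : EuclideanSpace ℝ (Fin n)) :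
    ∑ i, ∑ j, (partialDeriv (partialDeriv (h ∘ ψ) j) i y -
        ∑ k, Γ k i j y * partialDeriv (h ∘ ψ) k y) * v i * v j =
      inner ℝ (G' (fderiv ℝ ψ y v)) (fderiv ℝ ψ y v) +
        inner ℝ (G (ψ y)) (bilinOfCoeff (normalPart (coordFrame ψ) Γ y) v v) := by
  have hψd : ∀ᶠ z in 𝓝 y, DifferentiableAt ℝ ψ z := (hψ.eventually (by simp)).mono
    fun z hz ↦ hz.differentiableAt (by norm_num)
  have h1 : ∀ j, partialDeriv (h ∘ ψ) j =ᶠ[𝓝 y] fun z ↦ inner ℝ (G (ψ z)) (coordFrame ψ j z) := by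
    intro j
    filter_upwards [hψd] with z hz
    rw [partialDeriv, ((hh (ψ z)).comp z hz.hasFDerivAt).fderiv]
    rfl
  have h2 : ∀ i j, partialDeriv (partialDeriv (h ∘ ψ) j) i y =
      inner ℝ (G (ψ y)) (fderiv ℝ (coordFrame ψ j) y (EuclideanSpace.single i 1)) +
      inner ℝ (G' (coordFrame ψ i y)) (coordFrame ψ j y) := by
    intro i j
    have hGψ : HasFDerivAt (fun z ↦ G (ψ z)) (G'.comp (fderiv ℝ ψ y)) y :=
      hG.comp y hψd.self_of_nhds.hasFDerivAt
    rw [partialDeriv, (h1 j).fderiv_eq, fderiv_inner_apply ℝ hGψ.differentiableAt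
      ((contDiffAt_coordFrame hψ j).differentiableAt (by norm_num)), hGψ.fderiv]
    rfl
  have h3 : ∀ i j, partialDeriv (partialDeriv (h ∘ ψ) j) i y -
        ∑ k, Γ k i j y * partialDeriv (h ∘ ψ) k y =
      inner ℝ (G' (coordFrame ψ i y)) (coordFrame ψ j y) +
        inner ℝ (G (ψ y)) (normalPart (coordFrame ψ) Γ y i j) := by
    intro i j
    rw [h2, normalPart, inner_sub_right, inner_sum]
    simp only [inner_smul_right, (h1 _).eq_of_nhds]
    ring
  rw [← sum_smul_coordFrame, bilinOfCoeff_apply]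
  simp only [h3, map_sum, map_smul, sum_inner, inner_sum, inner_smul_left, inner_smul_right,
    RCLike.conj_to_real, ← Finset.sum_add_distrib]
  simp only [Finset.mul_sum, add_mul, Finset.sum_add_distrib]
  congr 1
  · rw [Finset.sum_comm]
    exact Finset.sum_congr rfl fun i _ ↦ Finset.sum_congr rfl fun j _ ↦ by ring
  · exact Finset.sum_congr rfl fun i _ ↦ Finset.sum_congr rfl fun j _ ↦ by ring

/-- The second fundamental form of a Kähler submanifold of small codimension takes opposite values
on `v` and `J v` for some `v ≠ 0`. -/
theorem exists_secondForm_add_eq_zero [FiniteDimensional ℝ F] (hψ : ContDiffAt ℝ 3 ψ y)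
    (hinj : Function.Injective (fderiv ℝ ψ y))
    {Γ : Fin n → Fin n → Fin n → EuclideanSpace ℝ (Fin n) → ℝ}
    {c : Fin n → Fin n → EuclideanSpace ℝ (Fin n) → ℝ}
    (hc : ∀ k j, ContDiffAt ℝ 2 (c k j) y)
    (hpar : ∀ᶠ z in 𝓝 y, ∀ i j k, partialDeriv (c k j) i z +
      ∑ l, (Γ k i l z * c l j z - Γ l i j z * c k l z) = 0)
    (horth : ∀ᶠ z in 𝓝 y, ∀ j l, inner ℝ (∑ k, c k j z • coordFrame ψ k z)
      (∑ k, c k l z • coordFrame ψ k z) = inner ℝ (coordFrame ψ j z) (coordFrame ψ l z))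
    (hnorm : ∀ᶠ z in 𝓝 y, ∀ i j l,
      inner ℝ (normalPart (coordFrame ψ) Γ z i j) (coordFrame ψ l z) = 0)
    (J : EuclideanSpace ℝ (Fin n) →ₗ[ℝ] EuclideanSpace ℝ (Fin n))
    (hJ : ∀ v, J (J v) = -v) (hJc : ∀ k j, c k j y = J (EuclideanSpace.single j 1) k)
    (hdim : 2 * Module.finrank ℝ F < 3 * n) :
    ∃ v, v ≠ 0 ∧ bilinOfCoeff (normalPart (coordFrame ψ) Γ y) v v +
      bilinOfCoeff (normalPart (coordFrame ψ) Γ y) (J v) (J v) = 0 := by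
  set A := normalPart (coordFrame ψ) Γ y with hA
  let T := LinearMap.range (fderiv ℝ ψ y : EuclideanSpace ℝ (Fin n) →ₗ[ℝ] F)
  have hn0 : ∀ i j l, inner ℝ (A i j) (coordFrame ψ l y) = 0 := hnorm.self_of_nhds
  have hmem : ∀ i j, A i j ∈ Tᗮ := by
    intro i j
    rw [Submodule.mem_orthogonal']
    rintro _ ⟨v, rfl⟩
    rw [ContinuousLinearMap.coe_coe, ← sum_smul_coordFrame, inner_sum]
    simp only [inner_smul_right, hn0, mul_zero, Finset.sum_const_zero]
  have hAsymm : ∀ i j, A i j = A j i := by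
    intro i j
    -- No symmetry of `Γ` is needed: `A i j - A j i` is both normal and tangential.
    rw [← sub_eq_zero, ← inner_self_eq_zero (𝕜 := ℝ)]
    have h1 : A i j - A j i = ∑ k, (Γ k j i y - Γ k i j y) • coordFrame ψ k y := by
      simp only [hA, normalPart, fderiv_coordFrame_symm (hψ.of_le (by norm_num)) i j, sub_smul,
        Finset.sum_sub_distrib]
      abel
    nth_rw 2 [h1]
    rw [inner_sum]
    simp only [inner_smul_right, inner_sub_left, hn0, sub_self, mul_zero, Finset.sum_const_zero]
  let α : EuclideanSpace ℝ (Fin n) →ₗ[ℝ] EuclideanSpace ℝ (Fin n) →ₗ[ℝ] Tᗮ :=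
    bilinOfCoeff fun i j ↦ ⟨A i j, hmem i j⟩
  have hα : ∀ v w, (α v w : F) = bilinOfCoeff A v w := by
    intro v w
    simp [α, bilinOfCoeff_apply]
  have hsymm : ∀ v w, α v w = α w v := by
    intro v w
    simp only [α, bilinOfCoeff_apply]
    rw [Finset.sum_comm]
    refine Finset.sum_congr rfl fun i _ ↦ Finset.sum_congr rfl fun j _ ↦ ?_
    simp only [hAsymm j i, mul_comm]
  have hsingle : ∀ i j, bilinOfCoeff A (EuclideanSpace.single i 1) (EuclideanSpace.single j 1) =
      A i j := by
    intro i j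
    rw [bilinOfCoeff_single_left, Finset.sum_eq_single j]
    · simp
    · intro b _ hb
      simp [hb]
    · simp
  have hflat : ∀ x y z t, inner ℝ (α x y) (α z t) - inner ℝ (α z y) (α x t) -
      (inner ℝ (α x (J y)) (α z (J t)) - inner ℝ (α z (J y)) (α x (J t))) = 0 := by
    intro v₁ v₂ v₃ v₄
    -- The identity is linear in each argument, so it is reduced, one slot at a time, to coordinate
    -- vectors, where it is `gauss_rotated_frame`.
    revert v₁
    refine eq_zero_of_single (fun _ _ ↦ ?_) (fun _ _ ↦ ?_) fun i ↦ ?_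
    · simp only [map_add, LinearMap.add_apply, inner_add_left, inner_add_right]; ring
    · simp only [map_smul, LinearMap.smul_apply, inner_smul_left, inner_smul_right,
        RCLike.conj_to_real]; ring
    revert v₂
    refine eq_zero_of_single (fun _ _ ↦ ?_) (fun _ _ ↦ ?_) fun j ↦ ?_
    · simp only [map_add, inner_add_left]; ring
    · simp only [map_smul, inner_smul_left, RCLike.conj_to_real]; ring
    revert v₃
    refine eq_zero_of_single (fun _ _ ↦ ?_) (fun _ _ ↦ ?_) fun k ↦ ?_
    · simp only [map_add, LinearMap.add_apply, inner_add_left, inner_add_right]; ring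
    · simp only [map_smul, LinearMap.smul_apply, inner_smul_left, inner_smul_right,
        RCLike.conj_to_real]; ring
    revert v₄
    refine eq_zero_of_single (fun _ _ ↦ ?_) (fun _ _ ↦ ?_) fun l ↦ ?_
    · simp only [map_add, inner_add_right]; ring
    · simp only [map_smul, inner_smul_right]; ring
    have := gauss_rotated_frame (fun j ↦ contDiffAt_coordFrame hψ j) hc hpar horth hnorm i j k l
    rw [sub_eq_zero]
    simpa only [Submodule.coe_inner, hα, hsingle, bilinOfCoeff_single_left _ _ (J _), ← hJc]
      using this
  -- The normal space has dimension `finrank F - n`, whose double is below `n` exactly when `2 *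
  -- finrank F < 3 * n`.
  have hT : Module.finrank ℝ T = n := by
    rw [LinearMap.finrank_range_of_inj hinj, finrank_euclideanSpace_fin]
  have hTo := Submodule.finrank_add_finrank_orthogonal T
  obtain ⟨v, hv0, hv⟩ := exists_add_eq_zero α J hsymm hJ
    (fun x y z t ↦ sub_eq_zero.1 (hflat x y z t))
    (by rw [finrank_euclideanSpace_fin]; omega)
  refine ⟨v, hv0, ?_⟩
  have := congrArg (Subtype.val) hv
  simpa [hα] using this

end Immersions

/-! ### Passage between the manifold and its charts -/

section Charts

open Filter Topology

variable {n : ℕ} {M : Type*} [TopologicalSpace M] [ChartedSpace (EuclideanSpace ℝ (Fin n)) M]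
  {x : M} {z : EuclideanSpace ℝ (Fin n)}

theorem target_mem_nhds (hz : z ∈ (extChartAt (𝓡 n) x).target) :
    (extChartAt (𝓡 n) x).target ∈ 𝓝 z :=
  (isOpen_extChartAt_target x).mem_nhds hz

/-- The matrix of the field of endomorphisms `J`, as an endomorphism of the coordinate space. -/
def chartEndo (J : ∀ x : M, TangentSpace (𝓡 n) x →L[ℝ] TangentSpace (𝓡 n) x) (x : M)
    (z : EuclideanSpace ℝ (Fin n)) : EuclideanSpace ℝ (Fin n) →ₗ[ℝ] EuclideanSpace ℝ (Fin n) where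
  toFun w := coords x ((extChartAt (𝓡 n) x).symm z) (J ((extChartAt (𝓡 n) x).symm z)
    (mfderiv 𝓘(ℝ, EuclideanSpace ℝ (Fin n)) (𝓡 n) (extChartAt (𝓡 n) x).symm z w))
  map_add' a b := by
    erw [map_add, map_add, coords, map_add]
    rfl
  map_smul' a b := by
    erw [map_smul, map_smul, coords, map_smul]
    rfl

theorem endoComp_eq_chartEndo (J : ∀ x : M, TangentSpace (𝓡 n) x →L[ℝ] TangentSpace (𝓡 n) x)
    (x : M) (z : EuclideanSpace ℝ (Fin n)) (k j : Fin n) :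
    endoComp J x k j z = chartEndo J x z (EuclideanSpace.single j 1) k := rfl

variable [IsManifold (𝓡 n) ∞ M]

theorem coords_mfderiv_symm (hz : z ∈ (extChartAt (𝓡 n) x).target)
    (w : EuclideanSpace ℝ (Fin n)) :
    coords x ((extChartAt (𝓡 n) x).symm z)
      (mfderiv 𝓘(ℝ, EuclideanSpace ℝ (Fin n)) (𝓡 n) (extChartAt (𝓡 n) x).symm z w) = w := by
  have := mfderiv_extChartAt_comp_mfderivWithin_extChartAt_symm (I := 𝓡 n) hz
  rw [modelWithCornersSelf_coe, Set.range_id, mfderivWithin_univ] at this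
  exact DFunLike.congr_fun this w

theorem mfderiv_symm_coords (hz : z ∈ (extChartAt (𝓡 n) x).target)
    (v : TangentSpace (𝓡 n) ((extChartAt (𝓡 n) x).symm z)) :
    mfderiv 𝓘(ℝ, EuclideanSpace ℝ (Fin n)) (𝓡 n) (extChartAt (𝓡 n) x).symm z
      (coords x ((extChartAt (𝓡 n) x).symm z) v) = v := by
  have := mfderivWithin_extChartAt_symm_comp_mfderiv_extChartAt (I := 𝓡 n) hz
  rw [modelWithCornersSelf_coe, Set.range_id, mfderivWithin_univ] at this
  exact DFunLike.congr_fun this v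

variable {N : ℕ} {φ : M → EuclideanSpace ℝ (Fin N)}

theorem contDiffAt_comp_symm {F : Type*} [NormedAddCommGroup F] [NormedSpace ℝ F] {φ : M → F}
    (hz : z ∈ (extChartAt (𝓡 n) x).target) {k : ℕ∞}
    (hφ : ContMDiffAt (𝓡 n) 𝓘(ℝ, F) k φ ((extChartAt (𝓡 n) x).symm z)) :
    ContDiffAt ℝ k (φ ∘ (extChartAt (𝓡 n) x).symm) z := by
  have h1 : ContMDiffAt 𝓘(ℝ, EuclideanSpace ℝ (Fin n)) (𝓡 n) k (extChartAt (𝓡 n) x).symm z :=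
    ((contMDiffOn_extChartAt_symm (n := ∞) x).contMDiffAt (target_mem_nhds hz)).of_le
      (by exact_mod_cast le_top)
  exact (hφ.comp z h1).contDiffAt

theorem mvfderiv_eq_fderiv (hφ : ContMDiff (𝓡 n) 𝓘(ℝ, EuclideanSpace ℝ (Fin N)) ∞ φ)
    (hz : z ∈ (extChartAt (𝓡 n) x).target)
    (v : TangentSpace (𝓡 n) ((extChartAt (𝓡 n) x).symm z)) :
    mvfderiv (𝓡 n) φ ((extChartAt (𝓡 n) x).symm z) v =
      fderiv ℝ (φ ∘ (extChartAt (𝓡 n) x).symm) z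
        (coords x ((extChartAt (𝓡 n) x).symm z) v) := by
  have h1 : MDifferentiableAt 𝓘(ℝ, EuclideanSpace ℝ (Fin n)) (𝓡 n) (extChartAt (𝓡 n) x).symm z :=
    (mdifferentiableOn_extChartAt_symm z hz).mdifferentiableAt (target_mem_nhds hz)
  have h2 : MDifferentiableAt (𝓡 n) 𝓘(ℝ, EuclideanSpace ℝ (Fin N)) φ
      ((extChartAt (𝓡 n) x).symm z) := (hφ _).mdifferentiableAt (by simp)
  have h3 := mfderiv_comp_apply z h2 h1 (coords x ((extChartAt (𝓡 n) x).symm z) v)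
  rw [mfderiv_eq_fderiv] at h3
  erw [mfderiv_symm_coords hz v] at h3
  exact h3.symm

theorem mvfderiv_coordField (hφ : ContMDiff (𝓡 n) 𝓘(ℝ, EuclideanSpace ℝ (Fin N)) ∞ φ)
    (hz : z ∈ (extChartAt (𝓡 n) x).target) (i : Fin n) :
    mvfderiv (𝓡 n) φ ((extChartAt (𝓡 n) x).symm z) (coordField x z i) =
      coordFrame (φ ∘ (extChartAt (𝓡 n) x).symm) i z := by
  rw [mvfderiv_eq_fderiv hφ hz, coordField, coords_mfderiv_symm hz]
  rfl

theorem chartEndo_sq (J : ∀ x : M, TangentSpace (𝓡 n) x →L[ℝ] TangentSpace (𝓡 n) x)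
    (hJ : ∀ x v, J x (J x v) = -v) (hz : z ∈ (extChartAt (𝓡 n) x).target)
    (w : EuclideanSpace ℝ (Fin n)) :
    chartEndo J x z (chartEndo J x z w) = -w := by
  change coords x _ (J _ (mfderiv 𝓘(ℝ, EuclideanSpace ℝ (Fin n)) (𝓡 n)
    (extChartAt (𝓡 n) x).symm z (coords x _ (J _ _)))) = _
  rw [mfderiv_symm_coords hz, hJ, coords, map_neg]
  exact congrArg Neg.neg (coords_mfderiv_symm hz w)

/-- The trivialization of the tangent bundle at `x` is the derivative of the chart at `x`, so `J`
read in it has the entries `endoComp` on the chart target. -/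
theorem contDiffAt_endoComp (J : ∀ x : M, TangentSpace (𝓡 n) x →L[ℝ] TangentSpace (𝓡 n) x)
    (hJ : ContMDiff (𝓡 n)
      ((𝓡 n).prod 𝓘(ℝ, EuclideanSpace ℝ (Fin n) →L[ℝ] EuclideanSpace ℝ (Fin n))) ∞
      (fun x ↦ Bundle.TotalSpace.mk' (EuclideanSpace ℝ (Fin n) →L[ℝ] EuclideanSpace ℝ (Fin n))
        (E := fun x : M ↦ TangentSpace (𝓡 n) x →L[ℝ] TangentSpace (𝓡 n) x) x (J x)))
    (x : M) (k j : Fin n) :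
    ContDiffAt ℝ 2 (endoComp J x k j) (extChartAt (𝓡 n) x x) := by
  have h1 := ((contMDiffAt_hom_bundle _).1 (hJ x)).2
  have hx : extChartAt (𝓡 n) x x ∈ (extChartAt (𝓡 n) x).target := mem_extChartAt_target x
  have h2 := contDiffAt_comp_symm (k := ⊤) hx (by rw [extChartAt_to_inv]; exact h1)
  have h3 : ContDiffAt ℝ 2 _ _ := ContDiffAt.of_le h2 (WithTop.coe_le_coe.2 (le_top : (2 : ℕ∞) ≤ ⊤))
  have h4 : ContDiffAt ℝ 2 (fun z ↦ EuclideanSpace.proj (𝕜 := ℝ) k (_ : EuclideanSpace ℝ (Fin n)))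
      _ := (EuclideanSpace.proj (𝕜 := ℝ) k).contDiff.contDiffAt.comp _
        (h3.clm_apply (contDiffAt_const (c := EuclideanSpace.single j (1 : ℝ))))
  refine h4.congr_of_eventuallyEq ?_
  filter_upwards [target_mem_nhds hx] with z hz
  have hs : (extChartAt (𝓡 n) x).symm z ∈ (chartAt (EuclideanSpace ℝ (Fin n)) x).source := by
    rw [← extChartAt_source (𝓡 n)]
    exact (extChartAt (𝓡 n) x).map_target hz
  simp only [Function.comp, ContinuousLinearMap.inCoordinates]
  rw [TangentBundle.continuousLinearMapAt_trivializationAt hs,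
    TangentBundle.symmL_trivializationAt hs, modelWithCornersSelf_coe, Set.range_id,
    mfderivWithin_univ, (extChartAt (𝓡 n) x).right_inv hz]
  rfl

end Charts

/-! ### Lower bound for the Hessian of a composition -/

section HessianBound

open Filter Topology

variable {n : ℕ} {M : Type*} [TopologicalSpace M] [ChartedSpace (EuclideanSpace ℝ (Fin n)) M]
  [IsManifold (𝓡 n) ∞ M]

/-- The tangent space at `x` is modelled through the preferred chart at `x`, whose derivative there
is the identity. -/
theorem coords_self (x : M) (v : TangentSpace (𝓡 n) x) : coords x x v = v := by
  have := mfderiv_extChartAt_self (I := 𝓡 n) (x := x)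
  exact DFunLike.congr_fun this v

variable {N : ℕ} {φ : M → EuclideanSpace ℝ (Fin N)}

/-- Stated at `x` itself, because `e.symm (e x)` equals `x` only propositionally and its tangent
space is a different type. -/
theorem mvfderiv_self (hφ : ContMDiff (𝓡 n) 𝓘(ℝ, EuclideanSpace ℝ (Fin N)) ∞ φ) (x : M)
    (v : TangentSpace (𝓡 n) x) :
    mvfderiv (𝓡 n) φ x v =
      fderiv ℝ (φ ∘ (extChartAt (𝓡 n) x).symm) (extChartAt (𝓡 n) x x) (coords x x v) := by
  have h : MDifferentiableAt (𝓡 n) 𝓘(ℝ, EuclideanSpace ℝ (Fin N)) φ x :=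
    (hφ x).mdifferentiableAt (by simp)
  rw [h.mvfderiv, coords_self, modelWithCornersSelf_coe, Set.range_id, fderivWithin_univ]
  rfl

variable [Bundle.RiemannianBundle (fun x : M ↦ TangentSpace (𝓡 n) x)]

theorem metricComp_eq (hφ : IsIsometricImmersion n φ) {x : M} {z : EuclideanSpace ℝ (Fin n)}
    (hz : z ∈ (extChartAt (𝓡 n) x).target) (i j : Fin n) :
    metricComp x i j z = inner ℝ (coordFrame (φ ∘ (extChartAt (𝓡 n) x).symm) i z)
      (coordFrame (φ ∘ (extChartAt (𝓡 n) x).symm) j z) := by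
  rw [metricComp, ← hφ.isometric, mvfderiv_coordField hφ.smooth hz,
    mvfderiv_coordField hφ.smooth hz]

theorem injective_fderiv_comp_symm (hφ : IsIsometricImmersion n φ) {x : M}
    {z : EuclideanSpace ℝ (Fin n)} (hz : z ∈ (extChartAt (𝓡 n) x).target) :
    Function.Injective (fderiv ℝ (φ ∘ (extChartAt (𝓡 n) x).symm) z) := by
  rw [injective_iff_map_eq_zero]
  intro w hw
  have h1 := mvfderiv_eq_fderiv hφ.smooth hz
    (mfderiv 𝓘(ℝ, EuclideanSpace ℝ (Fin n)) (𝓡 n) (extChartAt (𝓡 n) x).symm z w)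
  rw [coords_mfderiv_symm hz, hw] at h1
  have h2 := hφ.isometric _
    (mfderiv 𝓘(ℝ, EuclideanSpace ℝ (Fin n)) (𝓡 n) (extChartAt (𝓡 n) x).symm z w)
    (mfderiv 𝓘(ℝ, EuclideanSpace ℝ (Fin n)) (𝓡 n) (extChartAt (𝓡 n) x).symm z w)
  rw [h1, inner_zero_left, eq_comm, inner_self_eq_zero] at h2
  have h3 := coords_mfderiv_symm hz w
  rw [h2, coords, map_zero] at h3
  exact h3.symm

/-- Identifies the rotated frame with `dφ (J ∂ⱼ)`, so that orthogonality of `J` becomes equality of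
Gram matrices. -/
theorem sum_endoComp_smul_coordFrame (hφ : IsIsometricImmersion n φ)
    (J : ∀ x : M, TangentSpace (𝓡 n) x →L[ℝ] TangentSpace (𝓡 n) x) {x : M}
    {z : EuclideanSpace ℝ (Fin n)} (hz : z ∈ (extChartAt (𝓡 n) x).target) (j : Fin n) :
    ∑ k, endoComp J x k j z • coordFrame (φ ∘ (extChartAt (𝓡 n) x).symm) k z =
      mvfderiv (𝓡 n) φ ((extChartAt (𝓡 n) x).symm z)
        (J ((extChartAt (𝓡 n) x).symm z) (coordField x z j)) := by
  rw [mvfderiv_eq_fderiv hφ.smooth hz, ← sum_smul_coordFrame]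
  rfl

/-- For a Kähler submanifold of small codimension, some unit tangent vector `t` at `x` satisfies
`Hess (h ∘ φ) (t, t) ≥ Hess h (dφ t, dφ t)`. -/
theorem exists_le_hess {J : ∀ x : M, TangentSpace (𝓡 n) x →L[ℝ] TangentSpace (𝓡 n) x}
    (hJ : IsKahler J) (hφ : IsIsometricImmersion n φ) (hdim : 2 * N < 3 * n) (x : M)
    {h : EuclideanSpace ℝ (Fin N) → ℝ} {G : EuclideanSpace ℝ (Fin N) → EuclideanSpace ℝ (Fin N)}
    {G' : EuclideanSpace ℝ (Fin N) →L[ℝ] EuclideanSpace ℝ (Fin N)}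
    (hh : ∀ z, HasFDerivAt h (innerSL ℝ (G z)) z) (hG : HasFDerivAt G G' (φ x)) :
    ∃ (t : TangentSpace (𝓡 n) x) (w : EuclideanSpace ℝ (Fin N)), ‖t‖ = 1 ∧ ‖w‖ = 1 ∧
      inner ℝ (G' w) w ≤ hess (h ∘ φ) x t t := by
  set e := extChartAt (𝓡 n) x with he
  set ψ := φ ∘ e.symm with hψ
  have hx : e x ∈ e.target := mem_extChartAt_target x
  have hψ3 : ∀ z ∈ e.target, ContDiffAt ℝ 3 ψ z := fun z hz ↦
    contDiffAt_comp_symm (k := 3) hz ((hφ.smooth _).of_le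
      (WithTop.coe_le_coe.2 (le_top : (3 : ℕ∞) ≤ ⊤)))
  have hinj : ∀ z ∈ e.target, Function.Injective (fderiv ℝ ψ z) := fun z hz ↦
    injective_fderiv_comp_symm hφ hz
  have hψx : ψ (e x) = φ x := by simp [hψ, he]
  have hev : ∀ᶠ z in 𝓝 (e x), z ∈ e.target := target_mem_nhds hx
  have hnorm : ∀ z ∈ e.target, ∀ i j l,
      inner ℝ (normalPart (coordFrame ψ) (christoffel x) z i j) (coordFrame ψ l z) = 0 := by
    intro z hz
    refine inner_normalPart_coordFrame (hψ3 z hz) (hinj z hz) (metricComp x) (fun i j ↦ ?_) _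
      fun k i j ↦ rfl
    filter_upwards [target_mem_nhds hz] with y hy
    exact metricComp_eq hφ hy i j
  have horth : ∀ z ∈ e.target, ∀ j l, inner ℝ (∑ k, endoComp J x k j z • coordFrame ψ k z)
      (∑ k, endoComp J x k l z • coordFrame ψ k z) =
        inner ℝ (coordFrame ψ j z) (coordFrame ψ l z) := by
    intro z hz j l
    rw [sum_endoComp_smul_coordFrame hφ J hz, sum_endoComp_smul_coordFrame hφ J hz, hφ.isometric,
      hJ.orthogonal, ← metricComp_eq hφ hz]
    rfl
  obtain ⟨v, hv0, hv⟩ := exists_secondForm_add_eq_zero (hψ3 _ hx) (hinj _ hx)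
    (contDiffAt_endoComp J hJ.smooth x) (hev.mono fun z hz ↦ hJ.parallel x z hz)
    (hev.mono horth) (hev.mono hnorm) (chartEndo J x (e x)) (chartEndo_sq J hJ.sq_eq_neg hx)
    (fun k j ↦ endoComp_eq_chartEndo J x (e x) k j) (by simpa using hdim)
  set α := bilinOfCoeff (normalPart (coordFrame ψ) (christoffel x) (e x)) with hα
  -- The gradient pairs oppositely with `α` at `v` and at `Jv`; keep whichever vector gives the
  -- nonnegative sign.
  obtain ⟨v, hv0, hv⟩ : ∃ v, v ≠ 0 ∧ 0 ≤ inner ℝ (G (ψ (e x))) (α v v) := by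
    have hsum : inner ℝ (G (ψ (e x))) (α v v) +
        inner ℝ (G (ψ (e x))) (α (chartEndo J x (e x) v) (chartEndo J x (e x) v)) = 0 := by
      rw [← inner_add_right, hv, inner_zero_right]
    rcases le_total 0 (inner ℝ (G (ψ (e x))) (α v v)) with hpos | hneg
    · exact ⟨v, hv0, hpos⟩
    · refine ⟨chartEndo J x (e x) v, fun h0 ↦ hv0 ?_, by linarith⟩
      have := chartEndo_sq J hJ.sq_eq_neg hx v
      rw [h0, map_zero] at this
      exact neg_eq_zero.1 this.symm
  set w := fderiv ℝ ψ (e x) v with hw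
  have hw0 : ‖w‖ ≠ 0 := norm_ne_zero_iff.2 fun h0 ↦ hv0 (hinj _ hx (h0.trans (map_zero _).symm))
  let u : EuclideanSpace ℝ (Fin n) := ‖w‖⁻¹ • v
  let t : TangentSpace (𝓡 n) x := u
  have htu : coords x x t = u := coords_self x t
  have hdu : fderiv ℝ ψ (e x) u = ‖w‖⁻¹ • w := map_smul _ _ _
  have hw1 : ‖‖w‖⁻¹ • w‖ = 1 := by
    rw [norm_smul, norm_inv, norm_norm, inv_mul_cancel₀ hw0]
  refine ⟨t, ‖w‖⁻¹ • w, ?_, hw1, ?_⟩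
  · have h1 := hφ.isometric x t t
    rw [mvfderiv_self hφ.smooth, htu, ← he, ← hψ, hdu, real_inner_self_eq_norm_sq, hw1,
      real_inner_self_eq_norm_sq] at h1
    have := norm_nonneg t
    nlinarith
  · have h1 := hess_comp_eq (hψ3 _ hx) hh (by rwa [hψx]) (christoffel x) u
    unfold hess
    rw [htu]
    refine le_of_le_of_eq ?_ h1.symm
    rw [hdu, ← hα]
    have h3 : inner ℝ (G (ψ (e x))) (α u u) =
        ‖w‖⁻¹ * (‖w‖⁻¹ * inner ℝ (G (ψ (e x))) (α v v)) := by
      simp only [u, map_smul, LinearMap.smul_apply, inner_smul_right]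
    rw [h3]
    have : 0 ≤ ‖w‖⁻¹ := by positivity
    have : 0 ≤ ‖w‖⁻¹ * (‖w‖⁻¹ * inner ℝ (G (ψ (e x))) (α v v)) := by positivity
    linarith

end HessianBound

/-! ### The convex test function -/

section ConeFunction

variable {F : Type*} [NormedAddCommGroup F]

/-- `√(1 + a² |z - o|²)`. -/
def coneRadius (a : ℝ) (o z : F) : ℝ := √(1 + a ^ 2 * ‖z - o‖ ^ 2)

variable (a : ℝ) (o v z : F)

theorem coneRadius_pos : 0 < coneRadius a o z := Real.sqrt_pos.2 (by positivity)

theorem coneRadius_sq : coneRadius a o z ^ 2 = 1 + a ^ 2 * ‖z - o‖ ^ 2 :=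
  Real.sq_sqrt (by positivity)

theorem coneRadius_le (ha : 0 ≤ a) : coneRadius a o z ≤ 1 + a * ‖z - o‖ := by
  refine Real.sqrt_le_iff.2 ⟨by positivity, ?_⟩
  nlinarith [mul_nonneg ha (norm_nonneg (z - o))]

variable [InnerProductSpace ℝ F]

/-- A convex function, bounded above on the cones with vertex `o`, direction `v` and width
smaller than `arccos a`. -/
def coneFunction (a : ℝ) (o v z : F) : ℝ := coneRadius a o z - inner ℝ v (z - o)

/-- The gradient of `coneFunction`. -/
def coneGradient (a : ℝ) (o v z : F) : F := (a ^ 2 * (coneRadius a o z)⁻¹) • (z - o) - v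

theorem contDiff_coneRadius : ContDiff ℝ ∞ (coneRadius a o) := by
  unfold coneRadius
  refine ContDiff.sqrt (contDiff_const.add (contDiff_const.mul ?_)) fun z ↦ by positivity
  exact (contDiff_id.sub contDiff_const).norm_sq ℝ

theorem contDiff_coneFunction : ContDiff ℝ ∞ (coneFunction a o v) :=
  (contDiff_coneRadius a o).sub (contDiff_const.inner ℝ (contDiff_id.sub contDiff_const))

theorem hasFDerivAt_coneRadius :
    HasFDerivAt (coneRadius a o) ((a ^ 2 * (coneRadius a o z)⁻¹) • innerSL ℝ (z - o)) z := by
  have h1 : HasFDerivAt (fun z ↦ 1 + a ^ 2 * ‖z - o‖ ^ 2) (a ^ 2 • (2 • innerSL ℝ (z - o))) z := by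
    have := ((hasFDerivAt_id z).sub_const o).norm_sq
    exact (this.const_mul (a ^ 2)).const_add 1
  refine (h1.sqrt (by positivity)).congr_fderiv (ContinuousLinearMap.ext fun w ↦ ?_)
  change 1 / (2 * coneRadius a o z) * (a ^ 2 * (2 • inner ℝ (z - o) w)) =
    a ^ 2 * (coneRadius a o z)⁻¹ * inner ℝ (z - o) w
  have := (coneRadius_pos a o z).ne'
  rw [nsmul_eq_mul]
  push_cast
  field_simp

theorem hasFDerivAt_coneFunction :
    HasFDerivAt (coneFunction a o v) (innerSL ℝ (coneGradient a o v z)) z := by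
  have h1 : HasFDerivAt (fun z ↦ inner ℝ v (z - o)) (innerSL ℝ v) z :=
    (innerSL ℝ v).hasFDerivAt.comp z ((hasFDerivAt_id z).sub_const o)
  refine ((hasFDerivAt_coneRadius a o z).sub h1).congr_fderiv (ContinuousLinearMap.ext fun w ↦ ?_)
  change a ^ 2 * (coneRadius a o z)⁻¹ * inner ℝ (z - o) w - inner ℝ v w =
    inner ℝ (coneGradient a o v z) w
  rw [coneGradient, inner_sub_left (_ • _), inner_smul_left, RCLike.conj_to_real]

/-- `coneFunction` is strictly convex, uniformly on bounded sets. -/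
theorem exists_hasFDerivAt_coneGradient :
    ∃ G' : F →L[ℝ] F, HasFDerivAt (coneGradient a o v) G' z ∧
      ∀ w, a ^ 2 / coneRadius a o z ^ 3 * ‖w‖ ^ 2 ≤ inner ℝ (G' w) w := by
  have hs := coneRadius_pos a o z
  have h1 : HasFDerivAt (fun z ↦ a ^ 2 * (coneRadius a o z)⁻¹)
      (a ^ 2 • (-(coneRadius a o z ^ 2)⁻¹ • ((a ^ 2 * (coneRadius a o z)⁻¹) • innerSL ℝ (z - o))))
      z :=
    ((hasDerivAt_inv hs.ne').comp_hasFDerivAt z (hasFDerivAt_coneRadius a o z)).const_mul (a ^ 2)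
  refine ⟨_, (h1.smul ((hasFDerivAt_id z).sub_const o)).sub_const v, fun w ↦ ?_⟩
  have hcs : inner ℝ (z - o) w ^ 2 ≤ ‖z - o‖ ^ 2 * ‖w‖ ^ 2 := by
    rw [← mul_pow]
    exact sq_le_sq' (by linarith [neg_le_of_abs_le (abs_real_inner_le_norm (z - o) w)])
      (real_inner_le_norm _ _)
  have hsq := coneRadius_sq a o z
  set s := coneRadius a o z
  set q : ℝ := inner ℝ (z - o) w with hq
  change _ ≤ inner ℝ ((a ^ 2 * s⁻¹) • w +
    (a ^ 2 * (-(s ^ 2)⁻¹ * (a ^ 2 * s⁻¹ * q))) • (z - o)) w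
  rw [inner_add_left, inner_smul_left, inner_smul_left, real_inner_self_eq_norm_sq, ← hq,
    RCLike.conj_to_real, RCLike.conj_to_real]
  -- Substituting `s² = 1 + a²‖z - o‖²` leaves exactly the Cauchy–Schwarz defect of `z - o` and `w`.
  have : a ^ 2 * s⁻¹ * ‖w‖ ^ 2 + a ^ 2 * (-(s ^ 2)⁻¹ * (a ^ 2 * s⁻¹ * q)) * q -
      a ^ 2 / s ^ 3 * ‖w‖ ^ 2 = a ^ 4 / s ^ 3 * (‖z - o‖ ^ 2 * ‖w‖ ^ 2 - q ^ 2) := by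
    field_simp
    rw [hsq]
    ring
  have h4 : 0 ≤ a ^ 4 / s ^ 3 * (‖z - o‖ ^ 2 * ‖w‖ ^ 2 - q ^ 2) :=
    mul_nonneg (by positivity) (by linarith)
  linarith

end ConeFunction

/-! ### Contradiction with the maximum principle -/

theorem le_inner_of_mem_cone {N : ℕ} {o v z : EuclideanSpace ℝ (Fin N)} {θ : ℝ}
    (hz : z ∈ cone o v θ) : Real.cos θ * ‖z - o‖ ≤ inner ℝ v (z - o) := by
  obtain ⟨h0, h1⟩ := hz
  have hpos : 0 < ‖z - o‖ := norm_pos_iff.2 (sub_ne_zero.2 h0)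
  rw [inner_smul_left, RCLike.conj_to_real, one_div, inv_mul_eq_div, le_div_iff₀ hpos,
    real_inner_comm] at h1
  exact h1

end KahlerCone

end

theorem mainTheorem5 (m : ℕ) (hm : 1 ≤ m)
    {M : Type*} [TopologicalSpace M] [T2Space M] [SecondCountableTopology M] [ConnectedSpace M]
    [ChartedSpace (EuclideanSpace ℝ (Fin (2 * m))) M] [IsManifold (𝓡 (2 * m)) ∞ M]
    [Bundle.RiemannianBundle (fun x : M ↦ TangentSpace (𝓡 (2 * m)) x)]
    [IsContMDiffRiemannianBundle (𝓡 (2 * m)) ∞ (EuclideanSpace ℝ (Fin (2 * m)))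
      (fun x : M ↦ TangentSpace (𝓡 (2 * m)) x)]
    (J : ∀ x : M, TangentSpace (𝓡 (2 * m)) x →L[ℝ] TangentSpace (𝓡 (2 * m)) x)
    (hJ : KahlerCone.IsKahler J)
    (hwmp : KahlerCone.WeakMaxPrincipleHess (2 * m) M) :
    ¬ ∃ (C : Set (EuclideanSpace ℝ (Fin (3 * m - 1))))
        (φ : M → EuclideanSpace ℝ (Fin (3 * m - 1))),
      KahlerCone.IsNondegenerateCone C ∧
      KahlerCone.IsIsometricImmersion (2 * m) φ ∧ ∀ x, φ x ∈ C := by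
  open KahlerCone in
  rintro ⟨_, φ, ⟨o, v, θ, -, hθ0, hθ, rfl⟩, hφ, hmem⟩
  set b := Real.cos θ with hb
  have hbpos : 0 < b := Real.cos_pos_of_mem_Ioo ⟨by linarith, hθ⟩
  -- Half of `cos θ` makes the root grow slower than the axial term, leaving the coercive remainder
  -- `-a * ‖φ x - o‖`.
  set a := b / 2 with ha
  have hapos : 0 < a := by positivity
  have hle : ∀ x, coneFunction a o v (φ x) ≤ 1 - a * ‖φ x - o‖ := by
    intro x
    have h1 := le_inner_of_mem_cone (hmem x)
    have h2 := coneRadius_le a o (φ x) hapos.le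
    rw [coneFunction]
    have : b = 2 * a := by rw [ha]; ring
    rw [← hb, this] at h1
    linarith
  have hsmooth : ContMDiff (𝓡 (2 * m)) 𝓘(ℝ, ℝ) 2 (coneFunction a o v ∘ φ) :=
    ((contDiff_coneFunction a o v).contMDiff.comp hφ.smooth).of_le
      (WithTop.coe_le_coe.2 (le_top : (2 : ℕ∞) ≤ ⊤))
  have hbdd : BddAbove (Set.range (coneFunction a o v ∘ φ)) := by
    refine ⟨1, ?_⟩
    rintro _ ⟨x, rfl⟩
    have : 0 ≤ a * ‖φ x - o‖ := by positivity
    exact (hle x).trans (by linarith)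
  obtain ⟨x, hx⟩ := hwmp _ hsmooth hbdd
  set U := ⨆ z, (coneFunction a o v ∘ φ) z
  -- Along the sequence, `φ` stays bounded, so the Hessian has a positive lower bound.
  have hrad : ∀ k, 1 ≤ k → coneRadius a o (φ (x k)) ≤ 3 - U := by
    intro k hk
    have h1 := (hx k hk).1
    have h2 := hle (x k)
    have h3 := coneRadius_le a o (φ (x k)) hapos.le
    have h4 : 1 / (k : ℝ) ≤ 1 := by
      rw [div_le_one (by positivity)]
      exact_mod_cast hk
    -- From `U - 1 < 1 - a * ‖φ (x k) - o‖` the norm term is below `2 - U`, and `coneRadius` adds at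
    -- most `1`.
    simp only [Function.comp] at h1
    linarith
  have hUpos : 0 < 3 - U := (coneRadius_pos a o _).trans_le (hrad 1 le_rfl)
  -- The index used is `k + 1`, as the principle says nothing at index `0`.
  obtain ⟨k, hk⟩ := exists_nat_one_div_lt (show 0 < a ^ 2 / (3 - U) ^ 3 by positivity)
  have hk1 : 1 ≤ k + 1 := by omega
  obtain ⟨G', hG', hpos⟩ := exists_hasFDerivAt_coneGradient a o v (φ (x (k + 1)))
  -- The dimension condition is `2 * (3 * m - 1) < 3 * (2 * m)`; with truncated subtraction it needs
  -- `1 ≤ m`.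
  obtain ⟨t, w, ht, hw, htw⟩ := exists_le_hess hJ hφ (by omega) (x (k + 1))
    (fun z ↦ hasFDerivAt_coneFunction a o v z) hG'
  have hlt := (le_iSup₂ (f := fun (t : TangentSpace (𝓡 (2 * m)) (x (k + 1))) (_ : ‖t‖ = 1) ↦
    (hess (coneFunction a o v ∘ φ) (x (k + 1)) t t : EReal)) t ht).trans_lt (hx (k + 1) hk1).2
  rw [EReal.coe_lt_coe_iff] at hlt
  have h1 := hpos w
  rw [hw, one_pow, mul_one] at h1
  have h2 : a ^ 2 / (3 - U) ^ 3 ≤ a ^ 2 / coneRadius a o (φ (x (k + 1))) ^ 3 := by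
    have := coneRadius_pos a o (φ (x (k + 1)))
    have := hrad (k + 1) hk1
    gcongr
  push_cast at hlt
  linarith
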